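/- Let $HTop_*$ be the category of pointed topological spaces and pointed homotopy classes of pointed maps, and let $HPol_*$ be its full subcategory of pointed spaces having the pointed homotopy type of a pointed polyhedron (a simplicial complex with the weak topology). An inverse system $\mathbf X=(X_\lambda,p_{\lambda\lambda'},\Lambda)$ is indexed by a non-empty directed preordered set. For inverse systems $\mathbf Y=(Y_\mu,q_{\mu\mu'},M)$ and $\mathbf X$, a morphism $\mathbf Y\to\mathbf X$ of pro-$HPol_*$ is a class $[(f,f_\lambda)]$ of families $f_\lambda:Y_{f(\lambda)}\to X_\lambda$ (with $f:\Lambda\to M$) such that for $\lambda\le\lambda'$ one has $p_{\lambda\lambda'}f_{\lambda'}q_{f(\lambda')\mu}=f_\lambda q_{f(\lambda)\mu}$ for some $\mu\ge f(\lambda),f(\lambda')$, where $(f,f_\lambda)\sim(g,g_\lambda)$ if for each $\lambda$ one has $f_\lambda q_{f(\lambda)\mu}=g_\lambda q_{g(\lambda)\mu}$ for some $\mu\ge f(\lambda),g(\lambda)$. A morphism of pro$^*$-$HPol_*$ is a class $[(f,f^n_\lambda)]$ of families with sequences $f^n_\lambda:Y_{f(\lambda)}\to X_\lambda$, $n\in\mathbb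 N$, where both conditions are required, with one $\mu$, for all sufficiently large $n$. An $HPol_*$-expansion of $(X,x)$ is an inverse system $\mathbf X$ in $HPol_*$ with compatible morphisms $p_\lambda:(X,x)\to X_\lambda$ of $HTop_*$ such that (E1) every morphism $h:(X,x)\to P$ with $P\in HPol_*$ is $h=fp_\lambda$ for some $\lambda$ and $f:X_\lambda\to P$; (E2) if $f_0p_\lambda=f_1p_\lambda$ for $f_0,f_1:X_\lambda\to P$ with $P\in HPol_*$, then $f_0p_{\lambda\lambda'}=f_1p_{\lambda\lambda'}$ for some $\lambda'\ge\lambda$. Let $k\ge 0$ be an integer, let $(X,x)$ be a pointed topological space, let $\mathbf p:(X,x)\to\mathbf X=(X_\lambda,p_{\lambda\lambda'},\Lambda)$ be an $HPol_*$-expansion and let $\mathbf q:(S^k,*)\to\mathbf Y$ be an $HPol_*$-expansion of the pointed $k$-sphere (for example the rudimentary one). Let $\check\pi_k^{top}(X,x)=Sh((S^k,*),(X,x))$ be the set of shape morphisms $F=\langle\mathbf f\rangle$, represented by morphisms $\mathbf f:\mathbf Y\to\mathbf X$ of pro-$HPol_*$, with the topology that has as basis the sets $V_\lambda^F=\{G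 : p_\lambda\circ G=p_\lambda\circ F\}$, and let $\check\pi_k^{*top}(X,x)=Sh^*((S^k,*),(X,x))$ be the set of coarse shape morphisms, represented by morphisms of pro$^*$-$HPol_*$, with the topology that has as basis the analogous sets $V_\lambda^{F^*}$. Then: 1. The map $J:\check\pi_k^{top}(X,x)\to\check\pi_k^{*top}(X,x)$, $J(\langle(f,f_\lambda)\rangle)=\langle(f,f^n_\lambda=f_\lambda)\rangle$, is a topological embedding. 2. Consequently, if $\check\pi_k^{top}(X,x)$ is not discrete, then $\check\pi_k^{*top}(X,x)$ is not discrete. 3. For the Hawaiian earring $HE=\bigcup_{n\ge1}\{(a,b)\in\mathbb R^2:(a-\frac1n)^2+b^2=\frac1{n^2}\}$ with base point $p=(0,0)$, and any $HPol_*$-expansions of $(HE,p)$ and of $(S^1,*)$, neither $\check\pi_1^{top}(HE,p)$ nor $\check\pi_1^{*top}(HE,p)$ is discrete. -/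

import Mathlib

open CategoryTheory Opposite

universe u v w z t

noncomputable section

namespace CoarseShape

/-! ## Inverse systems, pro-categories and pro*-categories

An inverse system in `C` indexed by a directed preordered set `Λ` is a functor `Λᵒᵖ ⥤ C`. -/

section Pro

variable {C : Type v} [Category.{z} C]

/-- The bonding morphism `p_{l l'} : X_{l'} ⟶ X_l` for `l ≤ l'`. -/
abbrev bond {Λ : Type u} [Preorder Λ] (X : Λᵒᵖ ⥤ C) {l l' : Λ} (h : l ≤ l') :
    X.obj (op l') ⟶ X.obj (op l) :=
  X.map (homOfLE h).op

lemma bond_comp {Λ : Type u} [Preorder Λ] (X : Λᵒᵖ ⥤ C) {a b c : Λ} (h : a ≤ b) (h' : b ≤ c) :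
    bond X h' ≫ bond X h = bond X (h.trans h') := by
  rw [bond, bond, bond, ← X.map_comp]
  rfl

/-- The rudimentary inverse system `(A)`, indexed by a one-point set. -/
abbrev rud (A : C) : Unitᵒᵖ ⥤ C := (Functor.const _).obj A

variable {M : Type u} [Preorder M] {Λ : Type w} [Preorder Λ] {N : Type t} [Preorder N]

/-- An `S`-morphism `(f, f_l) : Y → X` of inverse systems. -/
structure SMor (Y : Mᵒᵖ ⥤ C) (X : Λᵒᵖ ⥤ C) where
  idx : Λ → M
  map : ∀ l, Y.obj (op (idx l)) ⟶ X.obj (op l)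
  coherent : ∀ l l' (h : l ≤ l'), ∃ (m : M) (h₁ : idx l ≤ m) (h₂ : idx l' ≤ m),
    bond Y h₂ ≫ map l' ≫ bond X h = bond Y h₁ ≫ map l

/-- An `S*`-morphism `(f, fⁿ_l) : Y → X` of inverse systems. -/
structure SStarMor (Y : Mᵒᵖ ⥤ C) (X : Λᵒᵖ ⥤ C) where
  idx : Λ → M
  map : ∀ (l : Λ), ℕ → (Y.obj (op (idx l)) ⟶ X.obj (op l))
  coherent : ∀ l l' (h : l ≤ l'), ∃ (m : M) (h₁ : idx l ≤ m) (h₂ : idx l' ≤ m) (n₀ : ℕ),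
    ∀ n, n₀ ≤ n → bond Y h₂ ≫ map l' n ≫ bond X h = bond Y h₁ ≫ map l n

/-- Equivalence of `S`-morphisms. -/
def SMor.Equiv {Y : Mᵒᵖ ⥤ C} {X : Λᵒᵖ ⥤ C} (f g : SMor Y X) : Prop :=
  ∀ l, ∃ (m : M) (h₁ : f.idx l ≤ m) (h₂ : g.idx l ≤ m),
    bond Y h₁ ≫ f.map l = bond Y h₂ ≫ g.map l

/-- Equivalence of `S*`-morphisms. -/
def SStarMor.Equiv {Y : Mᵒᵖ ⥤ C} {X : Λᵒᵖ ⥤ C} (f g : SStarMor Y X) : Prop :=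
  ∀ l, ∃ (m : M) (h₁ : f.idx l ≤ m) (h₂ : g.idx l ≤ m) (n₀ : ℕ),
    ∀ n, n₀ ≤ n → bond Y h₁ ≫ f.map l n = bond Y h₂ ≫ g.map l n

/-- Equalities between composites with bonding morphisms persist further along the system. -/
lemma bond_ext {Y : Mᵒᵖ ⥤ C} {A : C} {a b m m' : M} {f : Y.obj (op a) ⟶ A}
    {g : Y.obj (op b) ⟶ A} (ha : a ≤ m) (hb : b ≤ m) (h : m ≤ m')
    (e : bond Y ha ≫ f = bond Y hb ≫ g) :
    bond Y (ha.trans h) ≫ f = bond Y (hb.trans h) ≫ g := by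
  rw [← bond_comp Y ha h, ← bond_comp Y hb h, Category.assoc, Category.assoc, e]

lemma bond_push {Y : Mᵒᵖ ⥤ C} {A B D : C} {a b m m' : M} {f : Y.obj (op a) ⟶ A}
    {g : Y.obj (op b) ⟶ B} {x : B ⟶ A} {ha : a ≤ m} {hb : b ≤ m}
    (e : bond Y hb ≫ g ≫ x = bond Y ha ≫ f) (h : m ≤ m') (y : A ⟶ D) :
    bond Y (ha.trans h) ≫ f ≫ y = bond Y (hb.trans h) ≫ g ≫ x ≫ y := by
  have E := bond_ext hb ha h e
  rw [← Category.assoc, ← E]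
  simp only [Category.assoc]

instance SMor.setoid [IsDirectedOrder M] (Y : Mᵒᵖ ⥤ C) (X : Λᵒᵖ ⥤ C) : Setoid (SMor Y X) where
  r := SMor.Equiv
  iseqv :=
    { refl := fun f l => ⟨f.idx l, le_rfl, le_rfl, rfl⟩
      symm := fun h l => by
        obtain ⟨m, h₁, h₂, e⟩ := h l
        exact ⟨m, h₂, h₁, e.symm⟩
      trans := fun h h' l => by
        obtain ⟨m, h₁, h₂, e⟩ := h l
        obtain ⟨m', h₁', h₂', e'⟩ := h' l
        obtain ⟨c, hc, hc'⟩ := exists_ge_ge m m'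
        exact ⟨c, h₁.trans hc, h₂'.trans hc',
          (bond_ext h₁ h₂ hc e).trans (bond_ext h₁' h₂' hc' e')⟩ }

instance SStarMor.setoid [IsDirectedOrder M] (Y : Mᵒᵖ ⥤ C) (X : Λᵒᵖ ⥤ C) :
    Setoid (SStarMor Y X) where
  r := SStarMor.Equiv
  iseqv :=
    { refl := fun f l => ⟨f.idx l, le_rfl, le_rfl, 0, fun _ _ => rfl⟩
      symm := fun h l => by
        obtain ⟨m, h₁, h₂, n₀, e⟩ := h l
        exact ⟨m, h₂, h₁, n₀, fun n hn => (e n hn).symm⟩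
      trans := fun h h' l => by
        obtain ⟨m, h₁, h₂, n₀, e⟩ := h l
        obtain ⟨m', h₁', h₂', n₁, e'⟩ := h' l
        obtain ⟨c, hc, hc'⟩ := exists_ge_ge m m'
        exact ⟨c, h₁.trans hc, h₂'.trans hc', max n₀ n₁, fun n hn =>
          (bond_ext h₁ h₂ hc (e n (le_of_max_le_left hn))).trans
            (bond_ext h₁' h₂' hc' (e' n (le_of_max_le_right hn)))⟩ }

/-- Morphisms `Y → X` of the category pro-`C`. -/
def ProHom [IsDirectedOrder M] (Y : Mᵒᵖ ⥤ C) (X : Λᵒᵖ ⥤ C) := Quotient (SMor.setoid Y X)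

/-- Morphisms `Y → X` of the category pro*-`C`. -/
def ProStarHom [IsDirectedOrder M] (Y : Mᵒᵖ ⥤ C) (X : Λᵒᵖ ⥤ C) := Quotient (SStarMor.setoid Y X)

/-- The `S*`-morphism with the constant sequences `fⁿ_l = f_l`. -/
def SMor.toStar {Y : Mᵒᵖ ⥤ C} {X : Λᵒᵖ ⥤ C} (f : SMor Y X) : SStarMor Y X where
  idx := f.idx
  map l _ := f.map l
  coherent l l' h := by
    obtain ⟨m, h₁, h₂, e⟩ := f.coherent l l' h
    exact ⟨m, h₁, h₂, 0, fun _ _ => e⟩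

/-- The functor pro-`C` → pro*-`C` on morphisms: `[(f, f_l)] ↦ [(f, fⁿ_l = f_l)]`. -/
def ProHom.toStar [IsDirectedOrder M] {Y : Mᵒᵖ ⥤ C} {X : Λᵒᵖ ⥤ C} :
    ProHom Y X → ProStarHom Y X :=
  Quotient.map SMor.toStar fun _ _ h l => by
    obtain ⟨m, h₁, h₂, e⟩ := h l
    exact ⟨m, h₁, h₂, 0, fun _ _ => e⟩

/-- Composition of `S`-morphisms. -/
def SMor.comp [IsDirectedOrder M] {Y : Mᵒᵖ ⥤ C} {X : Λᵒᵖ ⥤ C} {Z : Nᵒᵖ ⥤ C}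
    (f : SMor Y X) (g : SMor X Z) : SMor Y Z where
  idx ν := f.idx (g.idx ν)
  map ν := f.map (g.idx ν) ≫ g.map ν
  coherent ν ν' h := by
    obtain ⟨l, h₁, h₂, e⟩ := g.coherent ν ν' h
    obtain ⟨m₁, a₁, b₁, e₁⟩ := f.coherent _ _ h₁
    obtain ⟨m₂, a₂, b₂, e₂⟩ := f.coherent _ _ h₂
    obtain ⟨m, hm₁, hm₂⟩ := exists_ge_ge m₁ m₂
    refine ⟨m, a₁.trans hm₁, a₂.trans hm₂, ?_⟩
    rw [Category.assoc]
    exact (bond_push e₂ hm₂ (g.map ν' ≫ bond Z h)).trans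
      ((congrArg (fun y => bond Y (b₂.trans hm₂) ≫ f.map l ≫ y) e).trans
        (bond_push e₁ hm₁ (g.map ν)).symm)

/-- Composition of `S*`-morphisms. -/
def SStarMor.comp [IsDirectedOrder M] {Y : Mᵒᵖ ⥤ C} {X : Λᵒᵖ ⥤ C} {Z : Nᵒᵖ ⥤ C}
    (f : SStarMor Y X) (g : SStarMor X Z) : SStarMor Y Z where
  idx ν := f.idx (g.idx ν)
  map ν n := f.map (g.idx ν) n ≫ g.map ν n
  coherent ν ν' h := by
    obtain ⟨l, h₁, h₂, k₀, e⟩ := g.coherent ν ν' h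
    obtain ⟨m₁, a₁, b₁, k₁, e₁⟩ := f.coherent _ _ h₁
    obtain ⟨m₂, a₂, b₂, k₂, e₂⟩ := f.coherent _ _ h₂
    obtain ⟨m, hm₁, hm₂⟩ := exists_ge_ge m₁ m₂
    refine ⟨m, a₁.trans hm₁, a₂.trans hm₂, max k₀ (max k₁ k₂), fun n hn => ?_⟩
    rw [Category.assoc]
    exact (bond_push (e₂ n (by omega)) hm₂ (g.map ν' n ≫ bond Z h)).trans
      ((congrArg (fun y => bond Y (b₂.trans hm₂) ≫ f.map l n ≫ y) (e n (by omega))).trans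
        (bond_push (e₁ n (by omega)) hm₁ (g.map ν n)).symm)

/-- Composition in pro-`C`. -/
def ProHom.comp [IsDirectedOrder M] [IsDirectedOrder Λ] {Y : Mᵒᵖ ⥤ C} {X : Λᵒᵖ ⥤ C}
    {Z : Nᵒᵖ ⥤ C} : ProHom Y X → ProHom X Z → ProHom Y Z :=
  Quotient.map₂ SMor.comp fun f f' hf g g' hg ν => by
    obtain ⟨l, h₁, h₂, e⟩ := hg ν
    obtain ⟨m₁, a₁, b₁, e₁⟩ := f.coherent _ _ h₁
    obtain ⟨m₂, a₂, b₂, e₂⟩ := f'.coherent _ _ h₂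
    obtain ⟨m₃, a₃, b₃, e₃⟩ := hf l
    obtain ⟨m', hm₁, hm₂⟩ := exists_ge_ge m₁ m₂
    obtain ⟨m, hm', hm₃⟩ := exists_ge_ge m' m₃
    refine ⟨m, a₁.trans (hm₁.trans hm'), a₂.trans (hm₂.trans hm'), ?_⟩
    have E₃ : bond Y (a₃.trans hm₃) ≫ f.map l ≫ bond X h₁ ≫ g.map ν =
        bond Y (b₃.trans hm₃) ≫ f'.map l ≫ bond X h₂ ≫ g'.map ν := by
      rw [e, ← Category.assoc, bond_ext a₃ b₃ hm₃ e₃, Category.assoc]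
    exact (bond_push e₁ (hm₁.trans hm') (g.map ν)).trans
      (E₃.trans (bond_push e₂ (hm₂.trans hm') (g'.map ν)).symm)

/-- Composition in pro*-`C`. -/
def ProStarHom.comp [IsDirectedOrder M] [IsDirectedOrder Λ] {Y : Mᵒᵖ ⥤ C} {X : Λᵒᵖ ⥤ C}
    {Z : Nᵒᵖ ⥤ C} : ProStarHom Y X → ProStarHom X Z → ProStarHom Y Z :=
  Quotient.map₂ SStarMor.comp fun f f' hf g g' hg ν => by
    obtain ⟨l, h₁, h₂, k₀, e⟩ := hg ν
    obtain ⟨m₁, a₁, b₁, k₁, e₁⟩ := f.coherent _ _ h₁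
    obtain ⟨m₂, a₂, b₂, k₂, e₂⟩ := f'.coherent _ _ h₂
    obtain ⟨m₃, a₃, b₃, k₃, e₃⟩ := hf l
    obtain ⟨m', hm₁, hm₂⟩ := exists_ge_ge m₁ m₂
    obtain ⟨m, hm', hm₃⟩ := exists_ge_ge m' m₃
    refine ⟨m, a₁.trans (hm₁.trans hm'), a₂.trans (hm₂.trans hm'),
      max (max k₀ k₁) (max k₂ k₃), fun n hn => ?_⟩
    have E₃ : bond Y (a₃.trans hm₃) ≫ f.map l n ≫ bond X h₁ ≫ g.map ν n =
        bond Y (b₃.trans hm₃) ≫ f'.map l n ≫ bond X h₂ ≫ g'.map ν n := by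
      rw [e n (by omega), ← Category.assoc, bond_ext a₃ b₃ hm₃ (e₃ n (by omega)), Category.assoc]
    exact (bond_push (e₁ n (by omega)) (hm₁.trans hm') (g.map ν n)).trans
      (E₃.trans (bond_push (e₂ n (by omega)) (hm₂.trans hm') (g'.map ν n)).symm)

/-- The morphism `X → (X_l)` of pro-`C` represented by the identity of `X_l`. -/
def toTerm [IsDirectedOrder Λ] (X : Λᵒᵖ ⥤ C) (l : Λ) : ProHom X (rud (X.obj (op l))) :=
  Quotient.mk _
    { idx := fun _ => l
      map := fun _ => 𝟙 _
      coherent := fun _ _ _ => ⟨l, le_rfl, le_rfl, by simp⟩ }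

/-- The morphism `X → (X_l)` of pro*-`C` represented by the identity of `X_l`. -/
def toTermStar [IsDirectedOrder Λ] (X : Λᵒᵖ ⥤ C) (l : Λ) : ProStarHom X (rud (X.obj (op l))) :=
  (toTerm X l).toStar

/-- A `P`-expansion `p : A → X = (X_l, p_{l l'}, Λ)` of an object `A`, where `P` is (the object
predicate of) a full subcategory. A morphism from the rudimentary system `(A)` to `X` is
a compatible family `p_l : A ⟶ X_l`. -/
structure Expansion (P : ObjectProperty C) (A : C) (Λ : Type w) [Preorder Λ]
    [IsDirectedOrder Λ] [Nonempty Λ] where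
  sys : Λᵒᵖ ⥤ C
  mem : ∀ l : Λ, P (sys.obj (op l))
  proj : ∀ l : Λ, A ⟶ sys.obj (op l)
  proj_bond : ∀ {l l' : Λ} (h : l ≤ l'), proj l' ≫ bond sys h = proj l
  /-- (E1) -/
  factor : ∀ (B : C), P B → ∀ h : A ⟶ B, ∃ (l : Λ) (f : sys.obj (op l) ⟶ B), proj l ≫ f = h
  /-- (E2) -/
  eq_later : ∀ (B : C), P B → ∀ (l : Λ) (f₀ f₁ : sys.obj (op l) ⟶ B),
    proj l ≫ f₀ = proj l ≫ f₁ → ∃ (l' : Λ) (h : l ≤ l'), bond sys h ≫ f₀ = bond sys h ≫ f₁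

variable [IsDirectedOrder M] [Nonempty M] [IsDirectedOrder Λ] [Nonempty Λ]
variable {P : ObjectProperty C} {B A : C}

/-- The set `Sh(B, A)` of shape morphisms `F = <𝐟>`, each given by its unique representative
`𝐟 : Y → X` in pro-`C` with respect to the expansions `q : B → Y` and `p : A → X`. -/
def Sh (q : Expansion P B M) (p : Expansion P A Λ) := ProHom q.sys p.sys

/-- The set `Sh*(B, A)` of coarse shape morphisms `F* = <𝐟*>`, each given by its unique
representative `𝐟* : Y → X` in pro*-`C` with respect to the expansions `q` and `p`. -/
def ShStar (q : Expansion P B M) (p : Expansion P A Λ) := ProStarHom q.sys p.sys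

/-- `V_l^F = {G ∈ Sh(B, A) | p_l ∘ G = p_l ∘ F}`. The shape morphism induced by `p_l : A ⟶ X_l`
is represented by `toTerm p.sys l`, as `X_l` is an expansion of itself. -/
def Sh.basic {q : Expansion P B M} {p : Expansion P A Λ} (l : Λ) (F : Sh q p) : Set (Sh q p) :=
  {G | ProHom.comp G (toTerm p.sys l) = ProHom.comp F (toTerm p.sys l)}

/-- `V_l^{F*} = {G* ∈ Sh*(B, A) | p_l ∘ G* = p_l ∘ F*}`. -/
def ShStar.basic {q : Expansion P B M} {p : Expansion P A Λ} (l : Λ) (F : ShStar q p) :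
    Set (ShStar q p) :=
  {G | ProStarHom.comp G (toTermStar p.sys l) = ProStarHom.comp F (toTermStar p.sys l)}

/-- The topology on shape morphisms with basis the sets `V_l^F`. -/
instance (q : Expansion P B M) (p : Expansion P A Λ) : TopologicalSpace (Sh q p) :=
  TopologicalSpace.generateFrom {V | ∃ (l : Λ) (F : Sh q p), V = Sh.basic l F}

/-- The topology on coarse shape morphisms with basis the sets `V_l^{F*}`. -/
instance (q : Expansion P B M) (p : Expansion P A Λ) : TopologicalSpace (ShStar q p) :=
  TopologicalSpace.generateFrom {V | ∃ (l : Λ) (F : ShStar q p), V = ShStar.basic l F}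

/-- The natural map `J : Sh(B, A) → Sh*(B, A)`, `<(f, f_l)> ↦ <(f, fⁿ_l = f_l)>`. -/
def J (q : Expansion P B M) (p : Expansion P A Λ) : Sh q p → ShStar q p := ProHom.toStar

end Pro

/-! ## The pointed homotopy category `HTop_*` -/

/-- A pointed topological space, as an object of `HTop_*`. -/
structure HTopPt : Type (u + 1) where
  carrier : Type u
  [top : TopologicalSpace carrier]
  pt : carrier

attribute [instance] HTopPt.top

/-- Pointed continuous maps. -/
def PtMap (X Y : HTopPt.{u}) := {f : C(X.carrier, Y.carrier) // f X.pt = Y.pt}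

/-- Homotopy relative to the base point. -/
instance PtMap.setoid (X Y : HTopPt.{u}) : Setoid (PtMap X Y) where
  r f g := f.1.HomotopicRel g.1 {X.pt}
  iseqv :=
    { refl := fun f => .refl f.1
      symm := fun h => h.symm
      trans := fun h h' => h.trans h' }

def PtMap.comp {X Y Z : HTopPt.{u}} (f : PtMap X Y) (g : PtMap Y Z) : PtMap X Z :=
  ⟨g.1.comp f.1, by simp [f.2, g.2]⟩

lemma PtMap.comp_homotopic {X Y Z : HTopPt.{u}} {f f' : PtMap X Y} (hf : f ≈ f')
    {g g' : PtMap Y Z} (hg : g ≈ g') : f.comp g ≈ f'.comp g' := by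
  have h₁ : f.comp g ≈ f'.comp g :=
    ContinuousMap.HomotopicRel.comp_continuousMap (f₀ := f.1) (f₁ := f'.1) hf g.1
  have h₂ : f'.comp g ≈ f'.comp g' := by
    obtain ⟨H⟩ := hg
    refine ⟨{ toHomotopy := H.toHomotopy.comp (ContinuousMap.Homotopy.refl f'.1), prop' := ?_ }⟩
    rintro s _ rfl
    have := H.eq_fst s (Set.mem_singleton Y.pt)
    simpa [PtMap.comp, f'.2, g.2] using this
  exact Setoid.trans h₁ h₂

/-- Morphisms of `HTop_*` are pointed homotopy classes of pointed maps. -/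
instance : Category.{u} HTopPt.{u} where
  Hom X Y := Quotient (PtMap.setoid X Y)
  id X := Quotient.mk _ ⟨ContinuousMap.id _, rfl⟩
  comp := Quotient.map₂ PtMap.comp fun _ _ hf _ _ hg => PtMap.comp_homotopic hf hg
  id_comp := by rintro X Y ⟨f⟩; rfl
  comp_id := by rintro X Y ⟨f⟩; rfl
  assoc := by rintro X Y Z W ⟨f⟩ ⟨g⟩ ⟨h⟩; rfl

/-! ## Polyhedra -/

/-- The points of the closed simplex spanned by `s`, in barycentric coordinates. -/
def closedSimplex {V : Type u} (s : Finset V) : Set (V → ℝ) :=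
  {x | (∀ a, 0 ≤ x a) ∧ (∀ a, a ∉ s → x a = 0) ∧ ∑ a ∈ s, x a = 1}

/-- The underlying set of the geometric realization `|K|` of a simplicial complex. -/
def Realization {V : Type u} (K : PreAbstractSimplicialComplex V) : Type u :=
  {x : V → ℝ // ∃ s ∈ K, x ∈ closedSimplex s}

/-- The inclusion of a closed simplex in `|K|`. -/
def simplexIncl {V : Type u} (K : PreAbstractSimplicialComplex V) (s : {s : Finset V // s ∈ K}) :
    closedSimplex s.1 → Realization K :=
  fun x => ⟨x.1, s.1, s.2, x.2⟩

/-- The weak topology: a set is open in `|K|` iff its trace on every closed simplex is open. -/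
instance {V : Type u} (K : PreAbstractSimplicialComplex V) : TopologicalSpace (Realization K) :=
  ⨆ s : {s : Finset V // s ∈ K}, TopologicalSpace.coinduced (simplexIncl K s) inferInstance

/-- `HPol_*`: the full subcategory of `HTop_*` on the pointed spaces which have the pointed
homotopy type of a pointed polyhedron. -/
def HPolPt : ObjectProperty HTopPt.{u} := fun X =>
  ∃ (V : Type u) (K : PreAbstractSimplicialComplex V) (b : Realization K),
    Nonempty (X ≅ HTopPt.mk (Realization K) b)

/-! ## Spheres, the Hawaiian earring, and the topological (coarse) shape homotopy groups -/

/-- The pointed sphere `(S^k, *)`. -/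
def spherePt (k : ℕ) : HTopPt.{u} where
  carrier := ULift.{u} (Metric.sphere (0 : EuclideanSpace ℝ (Fin (k + 1))) 1)
  pt := ⟨EuclideanSpace.single 0 1, by simp⟩

/-- The union of the circles of radius `1 / n` and centre `(1 / n, 0)`, `n ≥ 1`. -/
def hawaiianSet : Set (ℝ × ℝ) :=
  {x | ∃ n : ℕ, 1 ≤ n ∧ (x.1 - 1 / (n : ℝ)) ^ 2 + x.2 ^ 2 = (1 / (n : ℝ)) ^ 2}

/-- The Hawaiian earring with base point `(0, 0)`. -/
def hawaiian : HTopPt.{0} where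
  carrier := hawaiianSet
  pt := ⟨(0, 0), 1, le_rfl, by norm_num⟩

/-- `HPol_*`-expansions of a pointed space. -/
abbrev HPolExpansion (X : HTopPt.{u}) (Λ : Type w) [Preorder Λ] [IsDirectedOrder Λ]
    [Nonempty Λ] :=
  Expansion HPolPt.{u} X Λ

section Groups

variable {k : ℕ} {X : HTopPt.{u}} {M : Type v} [Preorder M] [IsDirectedOrder M] [Nonempty M]
  {Λ : Type w} [Preorder Λ] [IsDirectedOrder Λ] [Nonempty Λ]

/-- The space `π̌_k^top(X, x) = Sh((S^k, *), (X, x))`, computed by expansions of `(S^k, *)` and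
`(X, x)`. -/
abbrev shapeHomotopy (q : HPolExpansion (spherePt.{u} k) M) (p : HPolExpansion X Λ) := Sh q p

/-- The space `π̌*_k^top(X, x) = Sh*((S^k, *), (X, x))`, computed by expansions of `(S^k, *)` and
`(X, x)`. -/
abbrev coarseShapeHomotopy (q : HPolExpansion (spherePt.{u} k) M) (p : HPolExpansion X Λ) :=
  ShStar q p

end Groups

end CoarseShape

end

namespace CoarseShape

/-! ### The comparison map `J`, and shape morphisms as compatible families of homotopy classes. -/

section Pro

variable {C : Type v} [Category.{z} C] {M : Type u} [Preorder M] [IsDirectedOrder M]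
  {Λ : Type w} [Preorder Λ] [IsDirectedOrder Λ]

/-! Embedding: the passage from pro-`C` to pro*-`C` respects composition and is faithful, because an
equality of constant sequences for all large `n` is just an equality. Hence `J` is injective and
`V_l^{J F}` pulls back exactly to `V_l^F` (`J_mem_basic`). This formal fact holds for any expansions
and gives `isEmbedding_J`. Non-discreteness passes along `J` because a subspace of a discrete space
is discrete.

Hawaiian earring: let `g n` be the loop around the `(n + 1)`-st circle and `c` the constant loop. By
`not_discreteTopology_sh` it suffices that every map to a polyhedron identifies some `g n` with `c`,
while each `g n` is distinguished from `c` by some map to a polyhedron. The first property makes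
every basic neighbourhood of the class of `c` contain some `g n`; the second makes the classes
distinct.

The first property (`exists_earringLoop_comp_eq`) is local contractibility of polyhedra: small
circles land in a neighbourhood of the base point that can be collapsed by a pointed homotopy. The
second (`exists_comp_ne`) is a winding number argument: project the earring radially, from a point
inside the `(n + 1)`-st circle but off the earring, to the boundary of a square. The image loop
winds once, so it has no continuous logarithm in `ℂ \ {0}`, whereas a null-homotopic one would. -/

lemma ProHom.toStar_comp {N : Type t} [Preorder N] {Y : Mᵒᵖ ⥤ C} {X : Λᵒᵖ ⥤ C} {Z : Nᵒᵖ ⥤ C}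
    (F : ProHom Y X) (G : ProHom X Z) :
    (F.comp G).toStar = ProStarHom.comp F.toStar G.toStar := by
  induction F using Quotient.inductionOn
  induction G using Quotient.inductionOn
  rfl

lemma ProHom.toStar_injective {Λ : Type w} [Preorder Λ] {Y : Mᵒᵖ ⥤ C} {X : Λᵒᵖ ⥤ C} :
    Function.Injective (ProHom.toStar : ProHom Y X → ProStarHom Y X) := by
  intro F G
  induction F using Quotient.inductionOn
  induction G using Quotient.inductionOn
  intro h
  refine Quotient.sound fun l => ?_
  obtain ⟨m, h₁, h₂, n₀, e⟩ := (Quotient.exact h :) l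
  exact ⟨m, h₁, h₂, e n₀ le_rfl⟩

variable [Nonempty M] [Nonempty Λ] {P : ObjectProperty C} {B A : C}
  {q : Expansion P B M} {p : Expansion P A Λ}

/-- `toTermStar` is by definition the image of `toTerm`, so functoriality and faithfulness of
`toStar` give both directions. -/
lemma J_mem_basic {l : Λ} {F G : Sh q p} :
    J q p G ∈ ShStar.basic l (J q p F) ↔ G ∈ Sh.basic l F := by
  have e (H : ProHom q.sys p.sys) := ProHom.toStar_comp H (toTerm p.sys l)
  exact ⟨fun h => ProHom.toStar_injective ((e G).trans (Eq.trans h (e F).symm)),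
    fun h => (e G).symm.trans ((congrArg ProHom.toStar h).trans (e F))⟩

lemma isEmbedding_J (q : Expansion P B M) (p : Expansion P A Λ) :
    Topology.IsEmbedding (J q p) := by
  refine ⟨⟨?_⟩, ProHom.toStar_injective⟩
  refine le_antisymm ?_ ?_
  · rw [← continuous_iff_le_induced]
    refine continuous_generateFrom_iff.2 ?_
    rintro _ ⟨l, F, rfl⟩
    -- The centre `F` need not lie in the image of `J`, so the neighbourhood is re-centred at `G`.
    refine isOpen_iff_forall_mem_open.2 fun G hG => ⟨Sh.basic l G, fun G' hG' => ?_,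
      .basic _ ⟨l, G, rfl⟩, rfl⟩
    exact (J_mem_basic.2 hG').trans hG
  · refine le_generateFrom ?_
    rintro _ ⟨l, F, rfl⟩
    exact ⟨ShStar.basic l (J q p F), .basic _ ⟨l, _, rfl⟩, Set.ext fun G => J_mem_basic⟩

/-- Two morphisms out of terms of an expansion which agree on the expanded object agree at some
later index. -/
lemma Expansion.exists_bond_eq (q : Expansion P B M) {D : C} (hD : P D) {a b : M}
    {f : q.sys.obj (op a) ⟶ D} {g : q.sys.obj (op b) ⟶ D} (h : q.proj a ≫ f = q.proj b ≫ g) :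
    ∃ (m : M) (ha : a ≤ m) (hb : b ≤ m), bond q.sys ha ≫ f = bond q.sys hb ≫ g := by
  obtain ⟨c, hac, hbc⟩ := exists_ge_ge a b
  obtain ⟨m, hm, e⟩ := q.eq_later D hD c (bond q.sys hac ≫ f) (bond q.sys hbc ≫ g) (by
    rw [← Category.assoc, ← Category.assoc, q.proj_bond, q.proj_bond, h])
  refine ⟨m, hac.trans hm, hbc.trans hm, ?_⟩
  rw [← bond_comp q.sys hac hm, ← bond_comp q.sys hbc hm, Category.assoc, Category.assoc, e]

lemma Expansion.proj_comp_eq (q : Expansion P B M) {D : C} {a b m : M}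
    {f : q.sys.obj (op a) ⟶ D} {g : q.sys.obj (op b) ⟶ D} {ha : a ≤ m} {hb : b ≤ m}
    (h : bond q.sys ha ≫ f = bond q.sys hb ≫ g) : q.proj a ≫ f = q.proj b ≫ g := by
  rw [← q.proj_bond ha, ← q.proj_bond hb, Category.assoc, Category.assoc, h]

/-- The composite of a shape morphism `B → A` with the projection `A ⟶ X_l`. -/
def Sh.comp (F : Sh q p) (l : Λ) : B ⟶ p.sys.obj (op l) :=
  Quotient.lift (fun f : SMor q.sys p.sys => q.proj (f.idx l) ≫ f.map l)
    (fun f g h => by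
      obtain ⟨m, h₁, h₂, e⟩ := h l
      exact q.proj_comp_eq e) F

lemma Sh.comp_bond (F : Sh q p) {l l' : Λ} (h : l ≤ l') :
    F.comp l' ≫ bond p.sys h = F.comp l := by
  induction F using Quotient.inductionOn with
  | h f =>
    obtain ⟨m, h₁, h₂, e⟩ := f.coherent l l' h
    exact (Category.assoc _ _ _).trans (q.proj_comp_eq e)

/-- Since `X_l` lies in `P`, (E2) for `q` lets an equality of morphisms on `B` be realized at a
later index of `Y`. The topology can thus be tested on actual morphisms `B ⟶ X_l`. -/
lemma Sh.mem_basic_iff {l : Λ} {F G : Sh q p} : G ∈ Sh.basic l F ↔ G.comp l = F.comp l := by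
  induction F using Quotient.inductionOn with
  | h f =>
    induction G using Quotient.inductionOn with
    | h g =>
      constructor
      · intro h
        obtain ⟨m, h₁, h₂, e⟩ := (Quotient.exact h :) ()
        have := q.proj_comp_eq e
        exact (congrArg _ (Category.comp_id _).symm).trans
          (this.trans (congrArg _ (Category.comp_id _)))
      · intro h
        obtain ⟨m, h₁, h₂, e⟩ := q.exists_bond_eq (p.mem l) h
        refine Quotient.sound fun _ => ⟨m, h₁, h₂, ?_⟩
        exact (congrArg _ (Category.comp_id _)).trans
          (e.trans (congrArg _ (Category.comp_id _).symm))

/-- The shape morphism induced by a morphism `B ⟶ A`. -/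
noncomputable def Sh.ofHom (q : Expansion P B M) (p : Expansion P A Λ) (g : B ⟶ A) : Sh q p :=
  Quotient.mk _
    { idx := fun l => (q.factor _ (p.mem l) (g ≫ p.proj l)).choose
      map := fun l => (q.factor _ (p.mem l) (g ≫ p.proj l)).choose_spec.choose
      coherent := fun l l' h => by
        have e := (q.factor _ (p.mem l) (g ≫ p.proj l)).choose_spec.choose_spec
        have e' := (q.factor _ (p.mem l') (g ≫ p.proj l')).choose_spec.choose_spec
        -- The factorizations chosen by (E1) at `l` and `l'` are unrelated, but they agree after
        -- composition with the projections from `B`, so (E2) makes them coherent.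
        obtain ⟨m, h₁, h₂, E⟩ := q.exists_bond_eq (p.mem l) (e.trans (by
          rw [← p.proj_bond h, ← Category.assoc, ← e', Category.assoc]))
        exact ⟨m, h₁, h₂, E.symm⟩ }

lemma Sh.comp_ofHom (g : B ⟶ A) (l : Λ) : (Sh.ofHom q p g).comp l = g ≫ p.proj l :=
  (q.factor _ (p.mem l) (g ≫ p.proj l)).choose_spec.choose_spec

/-- The topology is only declared as generated by the sets `V_l^F`. They form a basis since each is
a `V_l` around any of its points and, by directedness of `Λ`, two indices have a common refinement.
-/
lemma Sh.exists_basic_subset {U : Set (Sh q p)} (hU : IsOpen U) :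
    ∀ F ∈ U, ∃ l, Sh.basic l F ⊆ U := by
  induction hU with
  | basic s hs =>
    obtain ⟨l, F₀, rfl⟩ := hs
    exact fun F hF => ⟨l, fun G hG => Eq.trans (b := ProHom.comp F (toTerm p.sys l)) hG hF⟩
  | univ => exact fun F _ => ⟨Classical.arbitrary Λ, Set.subset_univ _⟩
  | inter s t _ _ hs ht =>
    intro F hF
    obtain ⟨l₁, h₁⟩ := hs F hF.1
    obtain ⟨l₂, h₂⟩ := ht F hF.2
    obtain ⟨l, hl₁, hl₂⟩ := exists_ge_ge l₁ l₂
    have aux : ∀ l', l' ≤ l → Sh.basic l F ⊆ Sh.basic l' F := fun l' hl G hG => by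
      rw [Sh.mem_basic_iff] at hG ⊢
      rw [← G.comp_bond hl, hG, F.comp_bond hl]
    exact ⟨l, fun G hG => ⟨h₁ (aux _ hl₁ hG), h₂ (aux _ hl₂ hG)⟩⟩
  | sUnion S _ ih =>
    rintro F ⟨s, hs, hF⟩
    obtain ⟨l, hl⟩ := ih s hs F hF
    exact ⟨l, hl.trans (Set.subset_sUnion_of_mem hs)⟩

/-- If the morphisms `g n : B ⟶ A` become equal to `c` in each `P`-object eventually, while each
of them is distinguished from `c` by a morphism to some `P`-object, then the space of shape
morphisms is not discrete. -/
lemma not_discreteTopology_sh (q : Expansion P B M) (p : Expansion P A Λ) (g : ℕ → (B ⟶ A))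
    (c : B ⟶ A) (hg : ∀ D, P D → ∀ f : A ⟶ D, ∃ n, g n ≫ f = c ≫ f)
    (hc : ∀ n, ∃ D, P D ∧ ∃ f : A ⟶ D, g n ≫ f ≠ c ≫ f) : ¬ DiscreteTopology (Sh q p) := by
  intro _
  obtain ⟨l, hl⟩ := Sh.exists_basic_subset (isOpen_discrete {Sh.ofHom q p c}) _ rfl
  obtain ⟨n, hn⟩ := hg _ (p.mem l) (p.proj l)
  have e : Sh.ofHom q p (g n) = Sh.ofHom q p c :=
    hl (Sh.mem_basic_iff.2 (by rw [Sh.comp_ofHom, Sh.comp_ofHom, hn]))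
  obtain ⟨D, hD, f, hf⟩ := hc n
  -- By (E1) the distinguishing morphism factors through some `X_l'`, where equal shape morphisms
  -- have equal components.
  obtain ⟨l', f', rfl⟩ := p.factor D hD f
  have e' := congrArg (fun F => Sh.comp F l') e
  simp only [Sh.comp_ofHom] at e'
  exact hf (by rw [← Category.assoc, e', Category.assoc])

end Pro
end CoarseShape

namespace CoarseShape

open scoped Topology

/-! ### Local contractibility of polyhedra, and the weak topology. -/

section Realization

variable {V : Type u} (K : PreAbstractSimplicialComplex V)

lemma isQuotientMap_simplexIncl : Topology.IsQuotientMap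
    fun x : (s : {s : Finset V // s ∈ K}) × closedSimplex s.1 => simplexIncl K x.1 x.2 := by
  refine ⟨⟨?_⟩, fun ⟨x, s, hs, hx⟩ => ⟨⟨⟨s, hs⟩, x, hx⟩, rfl⟩⟩
  rw [instTopologicalSpaceSigma, coinduced_iSup]
  simp only [coinduced_compose]
  rfl

lemma continuous_simplexIncl (s : {s : Finset V // s ∈ K}) : Continuous (simplexIncl K s) :=
  (isQuotientMap_simplexIncl K).continuous.comp continuous_sigmaMk

lemma continuous_realization_val : Continuous fun x : Realization K => x.1 := by
  rw [(isQuotientMap_simplexIncl K).continuous_iff, continuous_sigma_iff]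
  exact fun s => continuous_subtype_val

lemma convexComb_mem_closedSimplex {s : Finset V} {x y : V → ℝ} (hx : x ∈ closedSimplex s)
    (hy : y ∈ closedSimplex s) {c : ℝ} (h₀ : 0 ≤ c) (h₁ : c ≤ 1) :
    (fun a => (1 - c) * x a + c * y a) ∈ closedSimplex s := by
  refine ⟨fun a => ?_, fun a ha => ?_, ?_⟩
  · have := hx.1 a
    have := hy.1 a
    have : 0 ≤ 1 - c := by linarith
    positivity
  · simp [hx.2.1 a ha, hy.2.1 a ha]
  · rw [Finset.sum_add_distrib, ← Finset.mul_sum, ← Finset.mul_sum, hx.2.2, hy.2.2]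
    ring

/-- Polyhedra are pointed locally contractible in a strong sense: the identity is homotopic
relative to a point `b` to a map which is constant near `b`. -/
lemma exists_homotopy_const_near (b : Realization K) :
    ∃ H : C(unitInterval × Realization K, Realization K), (∀ x, H (0, x) = x) ∧ (∀ t, H (t, b) = b) ∧
      ∃ U ∈ 𝓝 b, ∀ x ∈ U, H (1, x) = b := by
  obtain ⟨s₀, hs₀, hb⟩ := b.2
  let σ : Finset V := {a ∈ s₀ | 0 < b.1 a}
  have hbσ : ∀ a ∈ σ, 0 < b.1 a := fun a ha => (Finset.mem_filter.1 ha).2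
  have hσb : ∀ a ∉ σ, b.1 a = 0 := fun a ha => by
    by_cases h : a ∈ s₀
    · exact le_antisymm (not_lt.1 fun h' => ha (Finset.mem_filter.2 ⟨h, h'⟩)) (hb.1 a)
    · exact hb.2.1 a h
  have hsum : ∑ a ∈ σ, b.1 a = 1 := by
    rw [← hb.2.2]
    exact Finset.sum_subset (Finset.filter_subset _ _) fun a _ ha => hσb a ha
  have hσ : ∀ s, σ ⊆ s → b.1 ∈ closedSimplex s := fun s hs =>
    ⟨hb.1, fun a ha => hσb a fun h => ha (hs h), by
      rw [← hsum]
      exact (Finset.sum_subset hs fun a _ ha => hσb a ha).symm⟩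
  -- A cut-off function: it vanishes on every simplex not containing the carrier `σ` of `b`. The
  -- factor 2 makes it exceed 1 at `b`, hence near `b`.
  let d : (V → ℝ) → ℝ := fun x => ∏ a ∈ σ, 2 * x a / b.1 a
  have hd : Continuous d := by
    refine continuous_finsetProd _ fun a _ => ?_
    fun_prop
  have hd₀ : ∀ x : V → ℝ, (∀ a, 0 ≤ x a) → 0 ≤ d x := fun x hx =>
    Finset.prod_nonneg fun a ha => div_nonneg (mul_nonneg zero_le_two (hx a)) (hbσ a ha).le
  have hdb : 1 < d b.1 := by
    have : d b.1 = 2 ^ σ.card := by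
      rw [← Finset.prod_const]
      refine Finset.prod_congr rfl fun a ha => ?_
      have := hbσ a ha
      field_simp
    rw [this]
    refine one_lt_pow₀ one_lt_two fun h => ?_
    rw [Finset.card_eq_zero.1 h, Finset.sum_empty] at hsum
    exact zero_ne_one hsum
  -- Push `x` straight towards `b` with speed `min 1 (d x)`. Simplices containing `σ` are preserved
  -- by convexity, all others are fixed pointwise, and where `d` is at least 1 the point reaches `b`
  -- at time 1.
  let h : unitInterval × (V → ℝ) → V → ℝ := fun p a =>
    (1 - p.1 * min 1 (d p.2)) * p.2 a + p.1 * min 1 (d p.2) * b.1 a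
  have hh : Continuous h := by
    refine continuous_pi fun a => ?_
    fun_prop
  have hmem : ∀ s, ∀ x ∈ closedSimplex s, ∀ t : unitInterval, h (t, x) ∈ closedSimplex s := by
    intro s x hx t
    have h₀ : 0 ≤ min 1 (d x) := le_min zero_le_one (hd₀ x hx.1)
    by_cases hs : σ ⊆ s
    · exact convexComb_mem_closedSimplex hx (hσ s hs) (mul_nonneg t.2.1 h₀)
        (mul_le_one₀ t.2.2 h₀ (min_le_left _ _))
    · obtain ⟨a, ha, has⟩ := Finset.not_subset.1 hs
      have : d x = 0 := Finset.prod_eq_zero ha (by simp [hx.2.1 a has])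
      simpa [h, this] using hx
  let H : unitInterval × Realization K → Realization K := fun p =>
    ⟨h (p.1, p.2.1), p.2.2.imp fun s hs => ⟨hs.1, hmem s _ hs.2 p.1⟩⟩
  have hH : Continuous H := by
    -- The product of a quotient map with the locally compact unit interval is again a quotient map,
    -- so continuity can be checked on each simplex times the interval.
    refine (isQuotientMap_simplexIncl K).continuous_lift_prod_right ?_
    rw [← (Homeomorph.prodComm _ _).comp_continuous_iff',
      ← Homeomorph.sigmaProdDistrib.symm.comp_continuous_iff', continuous_sigma_iff]
    intro s
    exact (continuous_simplexIncl K s).comp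
      (f := fun p : closedSimplex s.1 × unitInterval => ⟨h (p.2, p.1.1), hmem s.1 _ p.1.2 p.2⟩)
      (Continuous.subtype_mk (hh.comp (by fun_prop)) _)
  refine ⟨⟨H, hH⟩, fun x => Subtype.ext (funext fun a => ?_),
    fun t => Subtype.ext (funext fun a => ?_), {x | 1 < d x.1}, ?_,
    fun x hx => Subtype.ext (funext fun a => ?_)⟩
  · change h (0, x.1) a = x.1 a
    simp [h]
  · change h (t, b.1) a = b.1 a
    simp only [h]
    ring
  · exact (isOpen_lt continuous_const (hd.comp (continuous_realization_val K))).mem_nhds hdb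
  · have hx : 1 < d x.1 := hx
    change h (1, x.1) a = b.1 a
    simp [h, min_eq_left hx.le]

lemma isCompact_closedSimplex (s : Finset V) : IsCompact (closedSimplex s) := by
  refine (isCompact_Icc (a := (0 : V → ℝ)) (b := 1)).of_isClosed_subset ?_ ?_
  · simp only [closedSimplex, Set.ofPred_and, Set.ofPred_forall]
    refine IsClosed.inter ?_ (IsClosed.inter ?_ ?_)
    · exact isClosed_iInter fun a => isClosed_le continuous_const (continuous_apply a)
    · exact isClosed_iInter fun a => isClosed_iInter fun _ =>
        isClosed_eq (continuous_apply a) continuous_const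
    · exact isClosed_eq (by fun_prop) continuous_const
  · intro x hx
    refine ⟨hx.1, fun a => ?_⟩
    by_cases ha : a ∈ s
    · rw [Pi.one_apply, ← hx.2.2]
      exact Finset.single_le_sum (fun i _ => hx.1 i) ha
    · simp [hx.2.1 a ha]

/-- For a finite complex the weak topology is the topology of pointwise convergence. -/
lemma isEmbedding_realization_val [Finite V] : Topology.IsEmbedding fun x : Realization K => x.1 := by
  have (s : {s : Finset V // s ∈ K}) : CompactSpace (closedSimplex s.1) :=
    isCompact_iff_compactSpace.1 (isCompact_closedSimplex s.1)
  have : CompactSpace (Realization K) :=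
    (isQuotientMap_simplexIncl K).surjective.compactSpace (isQuotientMap_simplexIncl K).continuous
  exact ((continuous_realization_val K).isClosedEmbedding Subtype.val_injective).isEmbedding

end Realization

/-! ### Logarithms of loops in the punctured plane. -/

section Winding

/-- The homotopy lifts through the covering `exp`, starting from the constant `log c`; the end of
the lift is the logarithm. -/
lemma exists_log_of_homotopic_const {S : Type*} [TopologicalSpace S] {f : C(S, {z : ℂ // z ≠ 0})}
    {c : {z : ℂ // z ≠ 0}} (h : (ContinuousMap.const S c).Homotopic f) :
    ∃ g : C(S, ℂ), ∀ s, Complex.exp (g s) = f s := by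
  obtain ⟨H⟩ := h
  let G := Complex.isCoveringMap_exp.liftHomotopy H.toContinuousMap
    (ContinuousMap.const S (Complex.log c)) (fun s => by
      simpa [Subtype.ext_iff] using (Complex.exp_log c.2).symm)
  refine ⟨G.comp ((ContinuousMap.const S 1).prodMk (ContinuousMap.id S)), fun s => ?_⟩
  have := congrFun (Complex.isCoveringMap_exp.liftHomotopy_lifts H.toContinuousMap
    (ContinuousMap.const S (Complex.log c)) (fun s => by
      simpa [Subtype.ext_iff] using (Complex.exp_log c.2).symm)) (1, s)
  exact (congrArg Subtype.val this).trans (congrArg Subtype.val (H.apply_one s))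

/-- A loop in `ℂ \ {0}` staying within a right angle of the unit circle has no logarithm. -/
lemma not_exists_log {m h : ℝ → ℂ} (hm : Continuous m) (hm₀ : ∀ θ, 0 < (m θ).re)
    (hmp : m (2 * Real.pi) = m 0) (hh : Continuous h) (hhp : h (2 * Real.pi) = h 0)
    (H : ∀ θ, Complex.exp (h θ) = Complex.exp (θ * Complex.I) * m θ) : False := by
  -- The principal logarithm is continuous on the right half-plane, so `k` is a continuous lift of
  -- the constant 1 and hence constant. By periodicity of `h` and `m`, however, it changes by `-2πi`
  -- over one turn.
  let k : ℝ → ℂ := fun θ => h θ - Complex.log (m θ) - θ * Complex.I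
  have hk : Continuous k := by
    have := hm.clog fun θ => Or.inl (hm₀ θ)
    fun_prop
  have hexp : ∀ θ, Complex.exp (k θ) = 1 := fun θ => by
    have : m θ ≠ 0 := fun e => by simpa [e] using hm₀ θ
    rw [Complex.exp_sub, Complex.exp_sub, Complex.exp_log this, H, mul_div_assoc, div_self this,
      mul_one, div_self (Complex.exp_ne_zero _)]
  have := Complex.isCoveringMap_exp.const_of_comp hk
    (fun a a' => Subtype.ext ((hexp a).trans (hexp a').symm)) (2 * Real.pi) 0
  simp only [k, hmp, hhp] at this
  have h0 : ((2 * Real.pi : ℝ) : ℂ) * Complex.I = 0 := by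
    have e : ((0 : ℝ) : ℂ) * Complex.I = 0 := by simp
    linear_combination e - this
  simp [Real.pi_ne_zero] at h0

end Winding

/-! ### The boundary of a square as a polyhedral model of the punctured plane. -/

section Square

/-- The boundary of a square: the simplicial complex with vertices `±e₀`, `±e₁` whose faces are
the sets without antipodal pairs. -/
def squareComplex : PreAbstractSimplicialComplex (Bool × Bool) where
  faces := {s | s.Nonempty ∧ ∀ i, ¬ ((i, true) ∈ s ∧ (i, false) ∈ s)}
  isRelLowerSet_faces := fun _ hs =>
    ⟨hs.1, fun _ ht ht' => ⟨ht', fun i hi => hs.2 i ⟨ht hi.1, ht hi.2⟩⟩⟩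

/-- Barycentric coordinates of the radial projection of a point of the plane to the square. -/
noncomputable def squareCoord (w : ℝ × ℝ) (a : Bool × Bool) : ℝ :=
  max (cond a.2 1 (-1) * cond a.1 w.1 w.2) 0 / (|w.1| + |w.2|)

lemma abs_add_abs_pos {w : ℝ × ℝ} (hw : w ≠ 0) : 0 < |w.1| + |w.2| := by
  refine lt_of_le_of_ne (by positivity) fun h => hw ?_
  have h₁ := abs_nonneg w.1
  have h₂ := abs_nonneg w.2
  exact Prod.ext (abs_eq_zero.1 (by linarith)) (abs_eq_zero.1 (by linarith))

lemma squareCoord_mem {w : ℝ × ℝ} (hw : w ≠ 0) :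
    ∃ s ∈ squareComplex, squareCoord w ∈ closedSimplex s := by
  have hN := abs_add_abs_pos hw
  -- The edge in the closed quadrant of `w`; for a zero coordinate either sign would do.
  refine ⟨{(true, decide (0 ≤ w.1)), (false, decide (0 ≤ w.2))}, ⟨by simp, ?_⟩, fun a => ?_,
    ?_, ?_⟩
  · rintro (_ | _) <;> simp [← not_lt]
  · exact div_nonneg (le_max_right _ _) hN.le
  · rintro ⟨_ | _, _ | _⟩ <;> simp [squareCoord] <;> intro h <;> left <;> linarith
  · rw [Finset.sum_pair (by simp)]
    simp only [squareCoord, cond_true, cond_false]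
    rw [← add_div, div_eq_one_iff_eq hN.ne']
    congr 1
    · rcases le_or_gt 0 w.1 with h | h
      · simp [h, abs_of_nonneg h]
      · simp [h.not_ge, abs_of_neg h, h.le]
    · rcases le_or_gt 0 w.2 with h | h
      · simp [h, abs_of_nonneg h]
      · simp [h.not_ge, abs_of_neg h, h.le]

/-- The radial projection of the punctured plane to the square. -/
noncomputable def toSquare : C({w : ℝ × ℝ // w ≠ 0}, Realization squareComplex) where
  toFun w := ⟨squareCoord w.1, squareCoord_mem w.2⟩
  continuous_toFun := by
    refine (isEmbedding_realization_val squareComplex).continuous_iff.2 ?_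
    refine continuous_pi fun ⟨i, j⟩ => ?_
    change Continuous fun w : {w : ℝ × ℝ // w ≠ 0} => squareCoord w.1 (i, j)
    simp only [squareCoord]
    refine Continuous.div ?_ (by fun_prop) fun w => (abs_add_abs_pos w.2).ne'
    cases i <;> simp only [cond_true, cond_false] <;> fun_prop

/-- The inclusion of the square in the punctured plane. -/
noncomputable def ofSquare : C(Realization squareComplex, {z : ℂ // z ≠ 0}) where
  toFun x := ⟨⟨x.1 (true, true) - x.1 (true, false), x.1 (false, true) - x.1 (false, false)⟩, by
    obtain ⟨x, s, hs, hx⟩ := x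
    intro h
    have h₁ : ∀ i, x (i, true) - x (i, false) = 0 := by
      rintro (_ | _)
      · exact congrArg Complex.im h
      · exact congrArg Complex.re h
    have h₂ : ∀ i, x (i, true) = 0 ∧ x (i, false) = 0 := fun i => by
      have := h₁ i
      by_cases hi : (i, true) ∈ s
      · have h' := hx.2.1 _ fun hi' => hs.2 i ⟨hi, hi'⟩
        exact ⟨by linarith, h'⟩
      · have h' := hx.2.1 _ hi
        exact ⟨h', by linarith⟩
    refine zero_ne_one ((Finset.sum_eq_zero ?_).symm.trans hx.2.2)
    rintro ⟨i, _ | _⟩ _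
    exacts [(h₂ i).2, (h₂ i).1]⟩
  continuous_toFun := by
    have h := continuous_realization_val squareComplex
    have h' : ∀ a, Continuous fun x : Realization squareComplex => x.1 a :=
      fun a => (continuous_apply a).comp h
    refine Continuous.subtype_mk ?_ _
    simp only [Complex.mk_eq_add_mul_I]
    have h₁ := Complex.continuous_ofReal.comp ((h' (true, true)).sub (h' (true, false)))
    have h₂ := Complex.continuous_ofReal.comp ((h' (false, true)).sub (h' (false, false)))
    exact h₁.add (h₂.mul continuous_const)

/-- Positive part minus negative part recovers each coordinate. The passage through the square only
rescales by a positive factor, so it leaves winding unchanged. -/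
lemma ofSquare_toSquare (w : {w : ℝ × ℝ // w ≠ 0}) :
    (ofSquare (toSquare w) : ℂ) = ((|w.1.1| + |w.1.2|)⁻¹ : ℝ) * ⟨w.1.1, w.1.2⟩ := by
  change (⟨squareCoord w.1 (true, true) - squareCoord w.1 (true, false),
    squareCoord w.1 (false, true) - squareCoord w.1 (false, false)⟩ : ℂ) = _
  apply Complex.ext <;>
  simp only [squareCoord, cond_true, cond_false, Complex.re_ofReal_mul, Complex.im_ofReal_mul] <;>
  rw [← sub_div, one_mul, neg_one_mul, max_zero_sub_max_neg_zero_eq_self, div_eq_inv_mul]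

end Square
end CoarseShape

namespace CoarseShape

open scoped Topology

/-! ### The loops of the Hawaiian earring: small in every polyhedron, yet each one detected by some
polyhedron. -/

section Earring

lemma sphere_sq_add_sq (s : (spherePt.{0} 1).carrier) :
    s.down.1 0 ^ 2 + s.down.1 1 ^ 2 = 1 := by
  have h := s.down.2
  rw [mem_sphere_zero_iff_norm, EuclideanSpace.norm_eq, Real.sqrt_eq_one] at h
  simpa [Fin.sum_univ_two] using h

lemma continuous_sphere_coord (i : Fin 2) :
    Continuous fun s : (spherePt.{0} 1).carrier => s.down.1 i := by
  change Continuous fun s : ULift (Metric.sphere (0 : EuclideanSpace ℝ (Fin 2)) 1) => s.down.1 i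
  fun_prop

/-- The loop in the Hawaiian earring around its `(n + 1)`-st circle. -/
noncomputable def earringLoop (n : ℕ) : PtMap (spherePt.{0} 1) hawaiian :=
  ⟨⟨fun s => ⟨((1 - s.down.1 0) / (n + 1), - s.down.1 1 / (n + 1)), n + 1, by omega, by
      have h := sphere_sq_add_sq s
      have : (n : ℝ) + 1 ≠ 0 := by positivity
      push_cast
      field_simp
      linarith⟩, Continuous.subtype_mk (by
        have h (i) := continuous_sphere_coord i
        exact ((continuous_const.sub (h 0)).div_const _).prodMk ((h 1).neg.div_const _)) _⟩, by
    refine Subtype.ext (Prod.ext ?_ ?_)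
    · change (1 - (EuclideanSpace.single (0 : Fin 2) (1 : ℝ)) 0) / ((n : ℝ) + 1) = 0
      simp
    · change -(EuclideanSpace.single (0 : Fin 2) (1 : ℝ)) 1 / ((n : ℝ) + 1) = 0
      simp⟩

/-- The constant pointed map. -/
def constMap (X Y : HTopPt.{u}) : PtMap X Y := ⟨.const _ Y.pt, rfl⟩

lemma dist_earringLoop_le (n : ℕ) (s : (spherePt.{0} 1).carrier) :
    dist ((earringLoop n).1 s).1 (0, 0) ≤ 2 / ((n : ℝ) + 1) := by
  have h := sphere_sq_add_sq s
  have hn : (0 : ℝ) < n + 1 := by positivity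
  change dist ((1 - s.down.1 0) / ((n : ℝ) + 1), - s.down.1 1 / ((n : ℝ) + 1)) (0, 0) ≤ _
  rw [Prod.dist_eq, Real.dist_eq, Real.dist_eq, sub_zero, sub_zero, abs_div, abs_div,
    abs_of_pos hn]
  refine max_le ?_ ?_ <;> gcongr <;> rw [abs_le] <;> constructor <;> nlinarith

/-- Every map from the Hawaiian earring to a polyhedron kills all small circles. -/
lemma exists_earringLoop_comp_eq (D : HTopPt.{0}) (hD : HPolPt D) (f : hawaiian ⟶ D) :
    ∃ n, (Quotient.mk _ (earringLoop n) : spherePt.{0} 1 ⟶ hawaiian) ≫ f =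
      (Quotient.mk _ (constMap _ _) : spherePt.{0} 1 ⟶ hawaiian) ≫ f := by
  obtain ⟨V, K, b, ⟨i⟩⟩ := hD
  obtain ⟨φ, hφ⟩ := Quotient.exists_rep (f ≫ i.hom)
  obtain ⟨H, H₀, Hb, U, hU, H₁⟩ := exists_homotopy_const_near K b
  have hpre : φ.1 ⁻¹' U ∈ 𝓝 hawaiian.pt := φ.1.continuous.continuousAt (by rw [φ.2]; exact hU)
  obtain ⟨ε, hε, hball⟩ := Metric.mem_nhds_iff.1
    (show _ ∈ @nhds hawaiianSet _ hawaiian.pt from hpre)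
  obtain ⟨n, hn⟩ := exists_nat_gt (2 / ε)
  refine ⟨n, ?_⟩
  rw [← cancel_mono i.hom, Category.assoc, Category.assoc, ← hφ]
  -- Since `n > 2 / ε`, the whole circle lies in the ball that `φ` sends into `U`, so applying `H`
  -- contracts its image to `b` with the base point fixed.
  refine Quotient.sound ⟨⟨⟨⟨fun p => H (p.1, φ.1 ((earringLoop n).1 p.2)), by fun_prop⟩,
    fun s => H₀ _, fun s => ?_⟩, ?_⟩⟩
  · refine (H₁ _ (hball ?_)).trans φ.2.symm
    refine (dist_earringLoop_le n s).trans_lt ?_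
    rw [div_lt_iff₀ hε] at hn
    rw [div_lt_iff₀ (by positivity)]
    linarith
  · rintro t _ rfl
    have : φ.1 ((earringLoop n).1 (spherePt.{0} 1).pt) = b := by rw [(earringLoop n).2, φ.2]
    change H (t, φ.1 ((earringLoop n).1 (spherePt.{0} 1).pt)) = φ.1 ((earringLoop n).1 _)
    rw [this, Hb]

/-- The `k`-th circle meets the axis only at `0` and `2 / k`, and `2 * k = 2 * n + 3` is impossible
by parity. The point lies strictly between `2 / (n + 2)` and `2 / (n + 1)`. -/
lemma notMem_hawaiianSet (n : ℕ) : ((4 / (2 * n + 3), 0) : ℝ × ℝ) ∉ hawaiianSet := by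
  rintro ⟨k, hk, h⟩
  have hk' : (k : ℝ) ≠ 0 := by positivity
  have hn : (2 * n + 3 : ℝ) ≠ 0 := by positivity
  dsimp only at h
  field_simp at h
  have h' : (4 * k : ℝ) = 2 * (2 * n + 3) := by
    have : (4 * k : ℝ) * (4 * k - 2 * (2 * n + 3)) = 0 := by linear_combination h
    rcases mul_eq_zero.1 this with h | h
    · simp [hk'] at h
    · linarith
  have h'' : 4 * k = 2 * (2 * n + 3) := by exact_mod_cast h'
  omega

/-- The map to the punctured plane measuring the position relative to a point which is enclosed by
the first `n + 1` circles of the Hawaiian earring only. -/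
noncomputable def earringToPlane (n : ℕ) : C(hawaiianSet, {w : ℝ × ℝ // w ≠ 0}) where
  toFun x := ⟨((4 / (2 * n + 3), 0) : ℝ × ℝ) - x.1, fun h =>
    notMem_hawaiianSet n (by rw [sub_eq_zero.1 h]; exact x.2)⟩

/-- If the projected loop were trivial, its image in `ℂ \ {0}` would have a logarithm on the circle,
hence a `2π`-periodic one in the angle, against `not_exists_log`. -/
lemma exists_comp_ne (n : ℕ) : ∃ D, HPolPt D ∧ ∃ f : hawaiian ⟶ D,
    (Quotient.mk _ (earringLoop n) : spherePt.{0} 1 ⟶ hawaiian) ≫ f ≠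
      (Quotient.mk _ (constMap _ _) : spherePt.{0} 1 ⟶ hawaiian) ≫ f := by
  let φ : C(hawaiianSet, Realization squareComplex) := toSquare.comp (earringToPlane n)
  refine ⟨⟨Realization squareComplex, φ hawaiian.pt⟩, ⟨_, _, _, ⟨Iso.refl _⟩⟩,
    Quotient.mk _ ⟨φ, rfl⟩, fun h => ?_⟩
  have hH : (φ.comp (earringLoop n).1).Homotopic (φ.comp (constMap (spherePt.{0} 1) hawaiian).1) :=
    (Quotient.exact h : ContinuousMap.HomotopicRel _ _ _).homotopic
  obtain ⟨g, hg⟩ := exists_log_of_homotopic_const (c := ofSquare (φ hawaiian.pt))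
    ((ContinuousMap.Homotopic.refl ofSquare).comp hH.symm)
  let e : ℝ → (spherePt.{0} 1).carrier := fun θ => ⟨!₂[Real.cos θ, Real.sin θ], by
    simp [EuclideanSpace.norm_eq, Fin.sum_univ_two]⟩
  have he : Continuous e := by
    refine continuous_uliftUp.comp (Continuous.subtype_mk ?_ _)
    fun_prop
  -- Relative to the chosen point, the loop is `(exp (iθ) + δ) / (n + 1)`. As `0 < δ < 1`, it equals
  -- `exp (iθ)` times `(1 + δ exp (-iθ)) / (n + 1)`, which stays in the right half-plane; `ρ`
  -- collects the positive scalars.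
  let δ : ℝ := (2 * n + 1) / (2 * n + 3)
  let w : ℝ → {w : ℝ × ℝ // w ≠ 0} := fun θ => earringToPlane n ((earringLoop n).1 (e θ))
  have hw : Continuous w :=
    (earringToPlane n).continuous.comp ((earringLoop n).1.continuous.comp he)
  let ρ : ℝ → ℝ := fun θ => (|(w θ).1.1| + |(w θ).1.2|)⁻¹ / (n + 1)
  have hρ₀ : ∀ θ, 0 < ρ θ := fun θ => by
    have := abs_add_abs_pos (w θ).2
    positivity
  have hρ : Continuous ρ := by
    refine Continuous.div_const (Continuous.inv₀ (by fun_prop) fun θ => ?_) _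
    exact (abs_add_abs_pos (w θ).2).ne'
  have hper : e (2 * Real.pi) = e 0 := by
    refine congrArg ULift.up (Subtype.ext ?_)
    simp
  refine not_exists_log (m := fun θ => ρ θ * (1 + δ * Complex.exp (-(θ * Complex.I))))
    (h := fun θ => g (e θ)) (by fun_prop) (fun θ => ?_) ?_ (by fun_prop)
    (congrArg g hper) (fun θ => ?_)
  · rw [Complex.re_ofReal_mul]
    refine mul_pos (hρ₀ θ) ?_
    have hδ₀ : 0 < δ := by positivity
    have hδ : δ < 1 := by
      rw [div_lt_one (by positivity)]
      linarith
    rw [← neg_mul, ← Complex.ofReal_neg, Complex.add_re, Complex.re_ofReal_mul,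
      Complex.exp_ofReal_mul_I_re, Complex.one_re]
    nlinarith [Real.neg_one_le_cos (-θ)]
  · have hρp : ρ (2 * Real.pi) = ρ 0 := by simp only [ρ, w, hper]
    have hexp : Complex.exp (-(((2 * Real.pi : ℝ) : ℂ) * Complex.I)) =
        Complex.exp (-(((0 : ℝ) : ℂ) * Complex.I)) := by
      simp [Complex.exp_neg]
    simp only [hρp, hexp]
  · rw [hg]
    refine (ofSquare_toSquare (w θ)).trans ?_
    have hn : (n + 1 : ℝ) ≠ 0 := by positivity
    have hn' : (2 * n + 3 : ℝ) ≠ 0 := by positivity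
    have h₁ : (w θ).1.1 = (δ + Real.cos θ) / (n + 1) := by
      change 4 / (2 * n + 3) - (1 - Real.cos θ) / ((n : ℝ) + 1) = _
      simp only [δ]
      field_simp
      ring
    have h₂ : (w θ).1.2 = Real.sin θ / (n + 1) := by
      change 0 - -Real.sin θ / ((n : ℝ) + 1) = _
      ring
    have h₃ : (⟨(w θ).1.1, (w θ).1.2⟩ : ℂ) =
        ((n + 1 : ℝ)⁻¹ : ℝ) * (Complex.exp (θ * Complex.I) + δ) := by
      apply Complex.ext
      · rw [h₁, Complex.re_ofReal_mul, Complex.add_re, Complex.exp_ofReal_mul_I_re,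
          Complex.ofReal_re, div_eq_inv_mul, add_comm δ]
      · rw [h₂, Complex.im_ofReal_mul, Complex.add_im, Complex.exp_ofReal_mul_I_im,
          Complex.ofReal_im, div_eq_inv_mul, add_zero]
    have h₄ : Complex.exp (θ * Complex.I) * Complex.exp (-(θ * Complex.I)) = 1 := by
      rw [← Complex.exp_add, add_neg_cancel, Complex.exp_zero]
    rw [h₃]
    simp only [ρ, div_eq_mul_inv, Complex.ofReal_mul]
    linear_combination (-((|(w θ).1.1| + |(w θ).1.2|)⁻¹ : ℝ) * ((n + 1 : ℝ)⁻¹ : ℝ) * δ : ℂ) * h₄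

end Earring

end CoarseShape

open CoarseShape in
theorem mainTheorem8 :
    -- `J` is a topological embedding, and non-discreteness passes along it
    (∀ (k : ℕ) (X : HTopPt.{u})
      (M : Type v) [Preorder M] [IsDirectedOrder M] [Nonempty M]
      (Λ : Type w) [Preorder Λ] [IsDirectedOrder Λ] [Nonempty Λ]
      (q : HPolExpansion (spherePt.{u} k) M) (p : HPolExpansion X Λ),
      Topology.IsEmbedding (J q p : shapeHomotopy q p → coarseShapeHomotopy q p) ∧
      (¬ DiscreteTopology (shapeHomotopy q p) → ¬ DiscreteTopology (coarseShapeHomotopy q p))) ∧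
    -- the Hawaiian earring
    (∀ (M : Type v) [Preorder M] [IsDirectedOrder M] [Nonempty M]
      (Λ : Type w) [Preorder Λ] [IsDirectedOrder Λ] [Nonempty Λ]
      (q : HPolExpansion (spherePt.{0} 1) M) (p : HPolExpansion hawaiian Λ),
      ¬ DiscreteTopology (shapeHomotopy q p) ∧ ¬ DiscreteTopology (coarseShapeHomotopy q p)) := by
  refine ⟨fun k X M _ _ _ Λ _ _ _ q p => ⟨isEmbedding_J q p, fun h h' =>
    h (isEmbedding_J q p).discreteTopology⟩, fun M _ _ _ Λ _ _ _ q p => ?_⟩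
  have h := not_discreteTopology_sh q p _ _ exists_earringLoop_comp_eq exists_comp_ne
  exact ⟨h, fun h' => h (isEmbedding_J q p).discreteTopology⟩
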